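/- There exist absolute constants $\tau_0\in(0,1)$ and $C'>0$ (independent of all dimensions, ranks, matrices and of $\beta$) such that the following holds. Let $S,D\in\mathbb{R}^{m\times n}$, let $r\in\{1,\dots,\min(m,n)-1\}$, and let $S=U\Sigma V^\top$ be a singular value decomposition, with $U\in\mathbb{R}^{m\times m}$ and $V\in\mathbb{R}^{n\times n}$ orthogonal and $\Sigma\in\mathbb{R}^{m\times n}$ carrying the singular values $\sigma_1(S)\ge\sigma_2(S)\ge\cdots\ge 0$ on its main diagonal and zeros elsewhere. Let $U_r$, $V_r$ consist of the first $r$ columns of $U$, $V$, and put $$P_L=I-U_rU_r^\top,\qquad P_R=I-V_rV_r^\top,\qquad S_\perp=P_LSP_R,\qquad D_\perp=P_LDP_R.$$ For $\beta\in[0,1]$ let $G(\beta)=S+\beta D$ and define the tail energy at rank $r$, the tail ratio and its fixed-subspace surrogate by $$E(\beta)=\min_{\operatorname{rank}(Q)\le r}\|G(\beta)-Q\|_F^2,\qquad \rho(\beta)=\frac{\sqrt{E(\beta)}}{\|G(\beta)\|_F},\qquad \widetilde\rho(\beta)=\frac{\|S_\perp+\beta D_\perp\|_F}{\|S+\beta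 D\|_F}.$$ Suppose that the spectral gap $\delta:=\sigma_r(S)-\sigma_{r+1}(S)$ is positive and that $\tau:=\beta\|D\|_2/\delta\le\tau_0$, where $\|\cdot\|_2$ is the spectral norm. Then $$|\rho(\beta)-\widetilde\rho(\beta)|\le C'\tau^2=C'\,\frac{\beta^2\|D\|_2^2}{\delta^2};$$ in particular $|\rho(\beta)-\widetilde\rho(\beta)|=O\!\left(\beta^2\|D\|_2^2/\delta^2\right)$ with an absolute implied constant. -/

import Mathlib

noncomputable section

namespace FSFOA

open Matrix

variable {m n : ℕ}

open scoped Matrix.Norms.Frobenius in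
/-- The Frobenius norm of a real matrix. -/
def frobNorm (A : Matrix (Fin m) (Fin n) ℝ) : ℝ := ‖A‖

open scoped Matrix.Norms.L2Operator in
/-- The spectral norm of a real matrix (its operator norm for the Euclidean norms). -/
def specNorm (A : Matrix (Fin m) (Fin n) ℝ) : ℝ := ‖A‖

/-- The singular values of a matrix in decreasing order, numbered from zero: `singVal A i` is
`σ_{i+1}(A)`, and it is `0` from index `min m n` on. -/
def singVal (A : Matrix (Fin m) (Fin n) ℝ) (i : ℕ) : ℝ :=
  (Matrix.toEuclideanLin A).singularValues i

/-- The `m × n` matrix with the singular values of `A` on its main diagonal and zeros elsewhere. -/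
def sigmaMatrix (A : Matrix (Fin m) (Fin n) ℝ) : Matrix (Fin m) (Fin n) ℝ :=
  Matrix.of fun i j => if (i : ℕ) = (j : ℕ) then singVal A i else 0

/-- `A = U Σ Vᵀ` is a (full) singular value decomposition of `A`. -/
structure IsSVD (A : Matrix (Fin m) (Fin n) ℝ) (U : Matrix (Fin m) (Fin m) ℝ)
    (V : Matrix (Fin n) (Fin n) ℝ) : Prop where
  left_orthogonal : U ∈ Matrix.orthogonalGroup (Fin m) ℝ
  right_orthogonal : V ∈ Matrix.orthogonalGroup (Fin n) ℝ
  eq_mul : A = U * sigmaMatrix A * Vᵀ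

/-- The matrix formed by the first `r` columns of a square matrix. -/
def leadingCols (U : Matrix (Fin n) (Fin n) ℝ) (r : ℕ) :
    Matrix (Fin n) {j : Fin n // (j : ℕ) < r} ℝ :=
  U.submatrix id Subtype.val

/-- The matrix `I - U_r U_rᵀ`, where `U_r` consists of the first `r` columns of `U`. -/
def complProj (U : Matrix (Fin n) (Fin n) ℝ) (r : ℕ) : Matrix (Fin n) (Fin n) ℝ :=
  1 - leadingCols U r * (leadingCols U r)ᵀ

/-- The tail energy at rank `r`: the minimum of `‖G - Q‖_F²` over all `Q` of rank at most `r`.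
It is written as an infimum over a nonempty closed set, which is attained. -/
def tailEnergy (r : ℕ) (G : Matrix (Fin m) (Fin n) ℝ) : ℝ :=
  ⨅ Q : {Q : Matrix (Fin m) (Fin n) ℝ // Q.rank ≤ r}, frobNorm (G - Q.1) ^ 2

/-- The tail ratio `√E(β) / ‖G(β)‖_F` of `G(β) = S + β D` at rank `r`. -/
def tailRatio (r : ℕ) (S D : Matrix (Fin m) (Fin n) ℝ) (β : ℝ) : ℝ :=
  Real.sqrt (tailEnergy r (S + β • D)) / frobNorm (S + β • D)

/-- The fixed-subspace surrogate `‖S_⊥ + β D_⊥‖_F / ‖S + β D‖_F`, where `A_⊥ = P_L A P_R` and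
`P_L = I - U_r U_rᵀ`, `P_R = I - V_r V_rᵀ`. -/
def surrogateRatio (r : ℕ) (S D : Matrix (Fin m) (Fin n) ℝ) (U : Matrix (Fin m) (Fin m) ℝ)
    (V : Matrix (Fin n) (Fin n) ℝ) (β : ℝ) : ℝ :=
  frobNorm (complProj U r * S * complProj V r + β • (complProj U r * D * complProj V r)) /
    frobNorm (S + β • D)

/-- The spectral gap `σ_r(S) - σ_{r+1}(S)`, for `r ≥ 1`. -/
def spectralGap (r : ℕ) (S : Matrix (Fin m) (Fin n) ℝ) : ℝ :=
  singVal S (r - 1) - singVal S r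

/-- The relative perturbation size `τ = β ‖D‖₂ / δ`. -/
def relPert (r : ℕ) (S D : Matrix (Fin m) (Fin n) ℝ) (β : ℝ) : ℝ :=
  β * specNorm D / spectralGap r S

end FSFOA

end

namespace FSFOA

open Matrix

variable {l m n : ℕ}

/-! After an orthogonal change of bases, `S` is rectangular diagonal and the perturbation `E = β D`
is measured against projections `P`, `P'` onto the first `r` coordinates. The off-diagonal blocks of
`E` are first order in `τ`, but a near-rotation removes them. Solving a pair of Sylvester equations,
with cost controlled by the gap (`specNorm_sylvester_le`), gives skew `K`, `J` of spectral norm at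
most `2τ` such that `(1 + K)(S + E)(1 + J)` is the block diagonal part of `S + E` plus a remainder
of second order (`one_add_mul_mul_one_add_eq`).

Since `K` is skew, `(1 + K)ᵀ(1 + K) = 1 + KᵀK`, so the near-rotation never shrinks a Frobenius norm
and stretches it only to second order. For a block diagonal matrix with separated blocks, the
distance to rank `r` is the norm of the trailing block (`frobNorm_le_frobNorm_add_sub`); that norm
is the surrogate.

The constant does not depend on the rank: the remainder is of size `√r τ² δ`, and `S + E` has
Frobenius norm at least `√r δ / 2`, because `r` singular values of `S` are at least `δ`. -/

/-! ### Frobenius and spectral norms -/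

theorem frobNorm_nonneg (A : Matrix (Fin m) (Fin n) ℝ) : 0 ≤ frobNorm A := by
  let _ := Matrix.frobeniusNormedAddCommGroup (m := Fin m) (n := Fin n) (α := ℝ)
  exact norm_nonneg A

theorem frobNorm_add_le (A B : Matrix (Fin m) (Fin n) ℝ) :
    frobNorm (A + B) ≤ frobNorm A + frobNorm B := by
  let _ := Matrix.frobeniusNormedAddCommGroup (m := Fin m) (n := Fin n) (α := ℝ)
  exact norm_add_le A B

theorem frobNorm_neg (A : Matrix (Fin m) (Fin n) ℝ) : frobNorm (-A) = frobNorm A := by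
  let _ := Matrix.frobeniusNormedAddCommGroup (m := Fin m) (n := Fin n) (α := ℝ)
  exact norm_neg A

theorem frobNorm_sub_le (A B : Matrix (Fin m) (Fin n) ℝ) :
    frobNorm (A - B) ≤ frobNorm A + frobNorm B := by
  simpa [sub_eq_add_neg, frobNorm_neg] using frobNorm_add_le A (-B)

theorem frobNorm_transpose (A : Matrix (Fin m) (Fin n) ℝ) : frobNorm Aᵀ = frobNorm A :=
  Matrix.frobenius_norm_transpose A

theorem frobNorm_sq (A : Matrix (Fin m) (Fin n) ℝ) :
    frobNorm A ^ 2 = ∑ i, ∑ j, A i j ^ 2 := by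
  have h : 0 ≤ ∑ i, ∑ j, A i j ^ 2 :=
    Finset.sum_nonneg fun i _ => Finset.sum_nonneg fun j _ => sq_nonneg _
  rw [frobNorm, Matrix.frobenius_norm_def, ← Real.sqrt_eq_rpow]
  simp only [Real.norm_eq_abs, Real.rpow_two, sq_abs]
  exact Real.sq_sqrt h

theorem frobNorm_sq_eq_trace (A : Matrix (Fin m) (Fin n) ℝ) :
    frobNorm A ^ 2 = (A * Aᵀ).trace := by
  rw [frobNorm_sq]
  simp [Matrix.trace, Matrix.mul_apply, sq]

theorem frobNorm_sq_eq_trace' (A : Matrix (Fin m) (Fin n) ℝ) :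
    frobNorm A ^ 2 = (Aᵀ * A).trace := by
  rw [frobNorm_sq_eq_trace, Matrix.trace_mul_comm]

theorem specNorm_nonneg (A : Matrix (Fin m) (Fin n) ℝ) : 0 ≤ specNorm A := by
  let _ := Matrix.instL2OpNormedAddCommGroup (m := Fin m) (n := Fin n) (𝕜 := ℝ)
  exact norm_nonneg A

theorem specNorm_add_le (A B : Matrix (Fin m) (Fin n) ℝ) :
    specNorm (A + B) ≤ specNorm A + specNorm B := by
  let _ := Matrix.instL2OpNormedAddCommGroup (m := Fin m) (n := Fin n) (𝕜 := ℝ)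
  exact norm_add_le A B

theorem specNorm_neg (A : Matrix (Fin m) (Fin n) ℝ) : specNorm (-A) = specNorm A := by
  let _ := Matrix.instL2OpNormedAddCommGroup (m := Fin m) (n := Fin n) (𝕜 := ℝ)
  exact norm_neg A

theorem specNorm_sub_le (A B : Matrix (Fin m) (Fin n) ℝ) :
    specNorm (A - B) ≤ specNorm A + specNorm B := by
  simpa [sub_eq_add_neg, specNorm_neg] using specNorm_add_le A (-B)

open scoped Matrix.Norms.L2Operator in
theorem specNorm_smul (c : ℝ) (A : Matrix (Fin m) (Fin n) ℝ) :
    specNorm (c • A) = |c| * specNorm A :=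
  norm_smul c A

theorem specNorm_mul_le (A : Matrix (Fin l) (Fin m) ℝ) (B : Matrix (Fin m) (Fin n) ℝ) :
    specNorm (A * B) ≤ specNorm A * specNorm B :=
  Matrix.l2_opNorm_mul A B

theorem specNorm_transpose (A : Matrix (Fin m) (Fin n) ℝ) : specNorm Aᵀ = specNorm A := by
  rw [← Matrix.conjTranspose_eq_transpose_of_trivial]
  exact Matrix.l2_opNorm_conjTranspose A

theorem specNorm_sq (A : Matrix (Fin m) (Fin n) ℝ) : specNorm A ^ 2 = specNorm (Aᵀ * A) := by
  rw [← Matrix.conjTranspose_eq_transpose_of_trivial, sq]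
  exact (Matrix.l2_opNorm_conjTranspose_mul_self A).symm

theorem sum_mulVec_sq_le (A : Matrix (Fin m) (Fin n) ℝ) (v : Fin n → ℝ) :
    ∑ i, (A *ᵥ v) i ^ 2 ≤ specNorm A ^ 2 * ∑ j, v j ^ 2 := by
  have h := Matrix.l2_opNorm_mulVec A (WithLp.toLp 2 v)
  have h2 := pow_le_pow_left₀ (norm_nonneg _) h 2
  rw [mul_pow, EuclideanSpace.norm_sq_eq, EuclideanSpace.norm_sq_eq] at h2
  simpa [specNorm] using h2

theorem specNorm_diagonal_le (d : Fin n → ℝ) {c : ℝ} (hc : 0 ≤ c) (h : ∀ i, |d i| ≤ c) :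
    specNorm (diagonal d) ≤ c := by
  have : specNorm (diagonal d) = ‖d‖ := Matrix.l2_opNorm_diagonal d
  rw [this]
  exact (pi_norm_le_iff_of_nonneg hc).2 h

theorem frobNorm_mul_le (A : Matrix (Fin l) (Fin m) ℝ) (B : Matrix (Fin m) (Fin n) ℝ) :
    frobNorm (A * B) ≤ frobNorm A * specNorm B := by
  refine le_of_sq_le_sq ?_ (mul_nonneg (frobNorm_nonneg A) (specNorm_nonneg B))
  rw [mul_pow, frobNorm_sq, frobNorm_sq, Finset.sum_mul]
  refine Finset.sum_le_sum fun i _ => ?_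
  have h := sum_mulVec_sq_le Bᵀ (A i)
  rw [specNorm_transpose, mul_comm, Matrix.mulVec_transpose] at h
  exact h

theorem frobNorm_mul_le' (A : Matrix (Fin l) (Fin m) ℝ) (B : Matrix (Fin m) (Fin n) ℝ) :
    frobNorm (A * B) ≤ specNorm A * frobNorm B := by
  have h := frobNorm_mul_le Bᵀ Aᵀ
  rwa [← Matrix.transpose_mul, frobNorm_transpose, frobNorm_transpose, specNorm_transpose,
    mul_comm] at h

/-! ### Orthogonal projections -/

theorem one_sub_idem {P : Matrix (Fin m) (Fin m) ℝ} (hi : P * P = P) :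
    (1 - P) * (1 - P) = 1 - P := by
  simp only [mul_sub, sub_mul, mul_one, one_mul, hi, sub_self, sub_zero]

/-- The squared Frobenius norm splits along a symmetric idempotent acting on the left. -/
theorem frobNorm_sq_split_left {P : Matrix (Fin m) (Fin m) ℝ} (hs : Pᵀ = P) (hi : P * P = P)
    (A : Matrix (Fin m) (Fin n) ℝ) :
    frobNorm A ^ 2 = frobNorm (P * A) ^ 2 + frobNorm ((1 - P) * A) ^ 2 := by
  have h1 : (P * A)ᵀ * (P * A) = Aᵀ * P * A := by
    rw [Matrix.transpose_mul, hs]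
    calc Aᵀ * P * (P * A) = Aᵀ * (P * P) * A := by simp only [Matrix.mul_assoc]
      _ = _ := by rw [hi]
  have h2 : ((1 - P) * A)ᵀ * ((1 - P) * A) = Aᵀ * A - Aᵀ * P * A := by
    rw [Matrix.transpose_mul, Matrix.transpose_sub, hs, Matrix.transpose_one]
    calc Aᵀ * (1 - P) * ((1 - P) * A) = Aᵀ * ((1 - P) * (1 - P)) * A := by
          simp only [Matrix.mul_assoc]
      _ = _ := by
          rw [one_sub_idem hi, Matrix.mul_sub, Matrix.sub_mul, Matrix.mul_one]
  rw [frobNorm_sq_eq_trace', frobNorm_sq_eq_trace', frobNorm_sq_eq_trace', h1, h2,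
    Matrix.trace_sub]
  ring

theorem frobNorm_sq_split_right {P : Matrix (Fin n) (Fin n) ℝ} (hs : Pᵀ = P) (hi : P * P = P)
    (A : Matrix (Fin m) (Fin n) ℝ) :
    frobNorm A ^ 2 = frobNorm (A * P) ^ 2 + frobNorm (A * (1 - P)) ^ 2 := by
  have h := frobNorm_sq_split_left hs hi Aᵀ
  rwa [frobNorm_transpose, ← frobNorm_transpose (P * Aᵀ), ← frobNorm_transpose ((1 - P) * Aᵀ),
    Matrix.transpose_mul, Matrix.transpose_mul, Matrix.transpose_sub, hs, Matrix.transpose_one,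
    Matrix.transpose_transpose] at h

theorem frobNorm_proj_mul_le {P : Matrix (Fin m) (Fin m) ℝ} (hs : Pᵀ = P) (hi : P * P = P)
    (A : Matrix (Fin m) (Fin n) ℝ) : frobNorm (P * A) ≤ frobNorm A := by
  refine le_of_sq_le_sq ?_ (frobNorm_nonneg A)
  rw [frobNorm_sq_split_left hs hi A]
  nlinarith [sq_nonneg (frobNorm ((1 - P) * A))]

theorem specNorm_proj_le {P : Matrix (Fin m) (Fin m) ℝ} (hs : Pᵀ = P) (hi : P * P = P) :
    specNorm P ≤ 1 := by
  have h := specNorm_sq P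
  rw [hs, hi] at h
  nlinarith [specNorm_nonneg P]

theorem specNorm_one_le : specNorm (1 : Matrix (Fin m) (Fin m) ℝ) ≤ 1 :=
  specNorm_proj_le Matrix.transpose_one (Matrix.one_mul 1)

/-! ### Low-rank approximation of block diagonal matrices -/

/-- The orthogonal projection onto the column space of a matrix. -/
theorem exists_column_projection (Q : Matrix (Fin m) (Fin n) ℝ) :
    ∃ P : Matrix (Fin m) (Fin m) ℝ, Pᵀ = P ∧ P * P = P ∧ P * Q = Q ∧ P.trace = Q.rank := by
  let W : Submodule ℝ (EuclideanSpace ℝ (Fin m)) := LinearMap.range (toEuclideanLin Q)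
  let e := Matrix.toEuclideanCLM (n := Fin m) (𝕜 := ℝ)
  let P : Matrix (Fin m) (Fin m) ℝ := e.symm W.starProjection
  have heP : e P = W.starProjection := e.apply_symm_apply _
  have hlin : toEuclideanLin P = W.starProjection.toLinearMap := by
    rw [← heP]; rfl
  refine ⟨P, ?_, ?_, ?_, ?_⟩
  · rw [← Matrix.conjTranspose_eq_transpose_of_trivial, ← Matrix.star_eq_conjTranspose]
    refine EquivLike.injective e ?_
    rw [map_star, heP]
    exact isSelfAdjoint_starProjection W
  · refine EquivLike.injective e ?_
    rw [map_mul, heP]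
    exact W.isIdempotentElem_starProjection
  · apply (toEuclideanLin (𝕜 := ℝ) (m := Fin m) (n := Fin n)).injective
    ext1 x
    have h1 : toEuclideanLin (P * Q) x = toEuclideanLin P (toEuclideanLin Q x) := by
      simp [Matrix.toLpLin_apply, Matrix.mulVec_mulVec]
    rw [h1, hlin]
    exact Submodule.starProjection_eq_self_iff.2 (LinearMap.mem_range_self _ x)
  -- The trace of a projection is the dimension of its range, here the rank of `Q`.
  · have hp : LinearMap.IsProj W (W.starProjection.toLinearMap) :=
      ⟨fun x => Submodule.starProjection_apply_mem W x,
        fun x hx => Submodule.starProjection_eq_self_iff.2 hx⟩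
    have h1 := hp.trace
    rw [← hlin, Matrix.toEuclideanLin_eq_toLin_orthonormal, Matrix.trace_toLin_eq] at h1
    rw [h1, Matrix.rank_eq_finrank_range_toLin Q (EuclideanSpace.basisFun (Fin m) ℝ).toBasis
      (EuclideanSpace.basisFun (Fin n) ℝ).toBasis]
    rw [← Matrix.toEuclideanLin_eq_toLin_orthonormal]

/-- If the leading block `A` dominates the trailing block `F`, then no matrix of rank at most `r`
is closer to `A + F` than `A` is. -/
theorem frobNorm_le_frobNorm_add_sub {r : ℕ} {P : Matrix (Fin m) (Fin m) ℝ}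
    {P' : Matrix (Fin n) (Fin n) ℝ} (hs : Pᵀ = P) (hi : P * P = P)
    (hs' : P'ᵀ = P') (hi' : P' * P' = P') (hr : frobNorm P ^ 2 = r)
    {A F Q : Matrix (Fin m) (Fin n) ℝ} (hA : A * P' = A) (hF : F * P' = 0) (hPF : P * F = 0)
    {c : ℝ} (hc : 0 ≤ c)
    (hAc : ∀ B : Matrix (Fin m) (Fin m) ℝ, c * frobNorm (B * P) ≤ frobNorm (B * A))
    (hFc : specNorm F ≤ c) (hQ : Q.rank ≤ r) :
    frobNorm F ≤ frobNorm (A + F - Q) := by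
  obtain ⟨R, hRs, hRi, hRQ, hRt⟩ := exists_column_projection Q
  refine le_of_sq_le_sq ?_ (frobNorm_nonneg _)
  -- `1 - R` annihilates `Q` and is a contraction, so `Q` drops out and only `R` remains.
  have h1 : frobNorm ((1 - R) * (A + F)) ^ 2 ≤ frobNorm (A + F - Q) ^ 2 := by
    have e : (1 - R) * (A + F) = (1 - R) * (A + F - Q) := by
      simp only [Matrix.mul_sub, Matrix.sub_mul, Matrix.one_mul, hRQ, sub_self, sub_zero]
    rw [e]
    refine pow_le_pow_left₀ (frobNorm_nonneg _) (frobNorm_proj_mul_le ?_ (one_sub_idem hRi) _) 2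
    rw [Matrix.transpose_sub, hRs, Matrix.transpose_one]
  have h2 : frobNorm ((1 - R) * (A + F)) ^ 2 =
      frobNorm ((1 - R) * A) ^ 2 + frobNorm ((1 - R) * F) ^ 2 := by
    rw [frobNorm_sq_split_right hs' hi' ((1 - R) * (A + F))]
    have e1 : (1 - R) * (A + F) * P' = (1 - R) * A := by
      rw [Matrix.mul_assoc, Matrix.add_mul, hA, hF, add_zero]
    have e2 : (1 - R) * (A + F) * (1 - P') = (1 - R) * F := by
      rw [Matrix.mul_assoc, Matrix.mul_sub, Matrix.mul_one, Matrix.add_mul, hA, hF, add_zero,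
        add_sub_cancel_left]
    rw [e1, e2]
  have h3 : c ^ 2 * frobNorm ((1 - R) * P) ^ 2 ≤ frobNorm ((1 - R) * A) ^ 2 := by
    rw [← mul_pow]
    exact pow_le_pow_left₀ (mul_nonneg hc (frobNorm_nonneg _)) (hAc _) 2
  have h4 := frobNorm_sq_split_left hRs hRi F
  have h5 : frobNorm (R * F) ^ 2 ≤ frobNorm (R * (1 - P)) ^ 2 * c ^ 2 := by
    have e : R * F = R * (1 - P) * F := by
      rw [Matrix.mul_assoc, Matrix.sub_mul, Matrix.one_mul, hPF, sub_zero]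
    rw [← mul_pow, e]
    exact pow_le_pow_left₀ (frobNorm_nonneg _) ((frobNorm_mul_le _ _).trans
      (mul_le_mul_of_nonneg_left hFc (frobNorm_nonneg _))) 2
  have h6 := frobNorm_sq_split_left hRs hRi P
  have h7 := frobNorm_sq_split_right hs hi R
  have h8 : frobNorm R ^ 2 ≤ r := by
    rw [frobNorm_sq_eq_trace, hRs, hRi, hRt]
    exact_mod_cast hQ
  have h9 : 0 ≤ c ^ 2 * (r - frobNorm R ^ 2) := mul_nonneg (sq_nonneg c) (sub_nonneg.2 h8)
  -- The common part `‖RP‖²` cancels: what `R` misses of `P` exceeds what it spends outside `P` by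
  -- `r - rank Q`. Hence the loss in `F` is paid for by what is left of `A`.
  have h10 : c ^ 2 * (r - frobNorm R ^ 2) =
      c ^ 2 * frobNorm ((1 - R) * P) ^ 2 - frobNorm (R * (1 - P)) ^ 2 * c ^ 2 := by
    rw [h7, ← hr, h6]; ring
  linarith

/-! ### First-order rotations -/

section Skew

variable {K : Matrix (Fin m) (Fin m) ℝ} (hK : Kᵀ = -K)

include hK

theorem transpose_one_add_mul_self_of_skew : (1 + K)ᵀ * (1 + K) = 1 + Kᵀ * K := by
  rw [Matrix.transpose_add, Matrix.transpose_one, hK]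
  noncomm_ring

/-- The cross terms cancel by skewness, so the square of the norm grows by exactly `‖KA‖²`. -/
theorem frobNorm_le_one_add_skew_mul (A : Matrix (Fin m) (Fin n) ℝ) :
    frobNorm A ≤ frobNorm ((1 + K) * A) := by
  refine le_of_sq_le_sq ?_ (frobNorm_nonneg _)
  have h : ((1 + K) * A)ᵀ * ((1 + K) * A) = Aᵀ * A + (K * A)ᵀ * (K * A) := by
    calc ((1 + K) * A)ᵀ * ((1 + K) * A) = Aᵀ * ((1 + K)ᵀ * (1 + K)) * A := by
          simp only [Matrix.transpose_mul, Matrix.mul_assoc]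
      _ = _ := by
          rw [transpose_one_add_mul_self_of_skew hK]
          simp only [Matrix.transpose_mul, Matrix.mul_assoc, Matrix.mul_add, Matrix.add_mul,
            Matrix.one_mul]
  rw [frobNorm_sq_eq_trace', frobNorm_sq_eq_trace', h, Matrix.trace_add, ← frobNorm_sq_eq_trace',
    ← frobNorm_sq_eq_trace']
  nlinarith [sq_nonneg (frobNorm (K * A))]

theorem frobNorm_le_mul_one_add_skew (A : Matrix (Fin n) (Fin m) ℝ) :
    frobNorm A ≤ frobNorm (A * (1 + K)) := by
  have h := frobNorm_le_one_add_skew_mul (K := Kᵀ) (by rw [hK, Matrix.transpose_neg, hK]) Aᵀ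
  rwa [frobNorm_transpose, ← Matrix.transpose_one, ← Matrix.transpose_add, ← Matrix.transpose_mul,
    frobNorm_transpose] at h

theorem specNorm_one_add_skew_sq_le : specNorm (1 + K) ^ 2 ≤ 1 + specNorm K ^ 2 := by
  rw [specNorm_sq, transpose_one_add_mul_self_of_skew hK, specNorm_sq K]
  exact (specNorm_add_le _ _).trans (by gcongr; exact specNorm_one_le)

/-- The Gram matrix `1 + KᵀK` is positive definite, whatever the size of `K`. -/
theorem isUnit_det_one_add_skew : IsUnit (1 + K).det := by
  have h : (1 + Kᵀ * K).PosDef := by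
    have := Matrix.PosDef.one.add_posSemidef (Matrix.posSemidef_conjTranspose_mul_self K)
    rwa [Matrix.conjTranspose_eq_transpose_of_trivial] at this
  have h2 := h.det_pos
  rw [← transpose_one_add_mul_self_of_skew hK, Matrix.det_mul, Matrix.det_transpose] at h2
  exact isUnit_iff_ne_zero.2 fun h0 => by simp [h0] at h2

end Skew

/-! ### Sylvester equations and the second-order estimate -/

/-- Solutions of the coupled Sylvester equations of two separated blocks are bounded by the
right-hand sides divided by the gap. -/
theorem specNorm_sylvester_le {P : Matrix (Fin m) (Fin m) ℝ}
    {P' : Matrix (Fin n) (Fin n) ℝ} (hs : Pᵀ = P) (hs' : P'ᵀ = P')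
    {S H : Matrix (Fin m) (Fin n) ℝ} {T H' : Matrix (Fin n) (Fin m) ℝ} (hST : S * T = P)
    (hTS : T * S = P') (hPS : P * S = S * P') {a b ε : ℝ} (ha : 0 < a) (hab : b < a)
    (hT : a * specNorm T ≤ 1) (hb : specNorm ((1 - P) * S) ≤ b)
    (hH : specNorm H ≤ ε) (hH' : specNorm H' ≤ ε)
    {X : Matrix (Fin m) (Fin m) ℝ} {Y : Matrix (Fin n) (Fin n) ℝ}
    (hPX : P * X = X) (hXP : X * P = 0) (hPY : P' * Y = Y) (hYP : Y * P' = 0)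
    (h1 : X * S + S * Y = -H) (h2 : Sᵀ * X + Y * Sᵀ = H') :
    specNorm X ≤ ε / (a - b) ∧ specNorm Y ≤ ε / (a - b) := by
  -- `T` inverts the leading block of `S`, so multiplying by that block stretches by at least `a`.
  -- Each equation then bounds one unknown by `ε` plus `b` times the other.
  have key : ∀ {p q k : ℕ} (W : Matrix (Fin p) (Fin q) ℝ) (Z : Matrix (Fin k) (Fin p) ℝ)
      (_ : a * specNorm Z ≤ 1) (V : Matrix (Fin k) (Fin q) ℝ) (_ : V = Z * W),
      a * specNorm V ≤ specNorm W := by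
    intro p q k W Z hZ V hV
    calc a * specNorm V ≤ a * (specNorm Z * specNorm W) := by
          rw [hV]; exact mul_le_mul_of_nonneg_left (specNorm_mul_le _ _) ha.le
      _ = a * specNorm Z * specNorm W := by ring
      _ ≤ 1 * specNorm W := mul_le_mul_of_nonneg_right hZ (specNorm_nonneg _)
      _ = _ := one_mul _
  have hY : a * specNorm Y ≤ ε + b * specNorm X := by
    refine (key (S * Y) T hT Y (by rw [← Matrix.mul_assoc, hTS, hPY])).trans ?_
    have e : S * Y = -H - X * ((1 - P) * S) := by
      rw [← Matrix.mul_assoc, Matrix.mul_sub, hXP, Matrix.mul_one, sub_zero, ← h1,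
        add_sub_cancel_left]
    rw [e]
    refine (specNorm_sub_le _ _).trans (add_le_add (by rwa [specNorm_neg]) ?_)
    refine (specNorm_mul_le _ _).trans ?_
    rw [mul_comm]
    exact mul_le_mul_of_nonneg_right hb (specNorm_nonneg _)
  have hX : a * specNorm X ≤ ε + b * specNorm Y := by
    refine (key (Sᵀ * X) Tᵀ (by rwa [specNorm_transpose]) X
      (by rw [← Matrix.mul_assoc, ← Matrix.transpose_mul, hST, hs, hPX])).trans ?_
    have e : Sᵀ * X = H' - Y * ((1 - P) * S)ᵀ := by
      rw [Matrix.sub_mul, hPS, Matrix.one_mul, Matrix.transpose_sub, Matrix.transpose_mul, hs',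
        Matrix.mul_sub, ← Matrix.mul_assoc, hYP, Matrix.zero_mul, sub_zero, ← h2,
        add_sub_cancel_right]
    rw [e]
    refine (specNorm_sub_le _ _).trans (add_le_add hH' ?_)
    refine (specNorm_mul_le _ _).trans ?_
    rw [mul_comm, specNorm_transpose]
    exact mul_le_mul_of_nonneg_right hb (specNorm_nonneg _)
  have hb0 : 0 ≤ b := (specNorm_nonneg _).trans hb
  have hd : 0 < a - b := sub_pos.2 hab
  rw [le_div_iff₀ hd, le_div_iff₀ hd]
  -- The inequality for the larger of the two norms closes on itself and yields the factor `a - b`.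
  rcases le_total (specNorm X) (specNorm Y) with h | h
  · have := mul_le_mul_of_nonneg_left h hb0
    have := mul_le_mul_of_nonneg_left h hd.le
    constructor <;> linarith
  · have := mul_le_mul_of_nonneg_left h hb0
    have := mul_le_mul_of_nonneg_left h hd.le
    constructor <;> linarith

/-- Conjugating by the first-order rotations `1 + K`, `1 + J` removes the off-diagonal blocks of
`S + E` up to a remainder of second order. -/
theorem one_add_mul_mul_one_add_eq {P : Matrix (Fin m) (Fin m) ℝ}
    {P' : Matrix (Fin n) (Fin n) ℝ} (hi : P * P = P) (hs : Pᵀ = P) (hs' : P'ᵀ = P')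
    {S E : Matrix (Fin m) (Fin n) ℝ} (hPS : P * S = S * P')
    {X : Matrix (Fin m) (Fin m) ℝ} {Y : Matrix (Fin n) (Fin n) ℝ}
    (h1 : X * S + S * Y = -(P * E * (1 - P')))
    (h2 : Sᵀ * X + Y * Sᵀ = P' * Eᵀ * (1 - P)) :
    (1 + (X - Xᵀ)) * (S + E) * (1 + (Y - Yᵀ)) =
      P * (S + E) * P' + (1 - P) * (S + E) * (1 - P') +
        ((X - Xᵀ) * E + E * (Y - Yᵀ) + (X - Xᵀ) * (S + E) * (Y - Yᵀ)) := by
  have h3 : Xᵀ * S + S * Yᵀ = (1 - P) * E * P' := by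
    have := congrArg Matrix.transpose h2
    simpa only [Matrix.transpose_add, Matrix.transpose_mul, Matrix.transpose_transpose,
      Matrix.transpose_sub, Matrix.transpose_one, hs, hs', Matrix.mul_assoc] using this
  -- The first equation takes care of the upper off-diagonal block of `E`, the transpose of the
  -- second one of the lower block.
  have h4 : (X - Xᵀ) * S + S * (Y - Yᵀ) = -(P * E * (1 - P')) - (1 - P) * E * P' := by
    rw [← h1, ← h3, Matrix.sub_mul, Matrix.mul_sub]; abel
  have h5 : P * S * P' = P * S := by rw [Matrix.mul_assoc, ← hPS, ← Matrix.mul_assoc, hi]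
  have h6 : P * (S + E) * P' + (1 - P) * (S + E) * (1 - P') =
      S + E - P * E * (1 - P') - (1 - P) * E * P' := by
    simp only [Matrix.mul_add, Matrix.add_mul, Matrix.mul_sub, Matrix.sub_mul, Matrix.mul_one,
      Matrix.one_mul, h5, ← hPS]
    abel
  rw [h6]
  have h7 : (1 + (X - Xᵀ)) * (S + E) * (1 + (Y - Yᵀ)) =
      S + E + ((X - Xᵀ) * S + S * (Y - Yᵀ)) +
        ((X - Xᵀ) * E + E * (Y - Yᵀ) + (X - Xᵀ) * (S + E) * (Y - Yᵀ)) := by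
    generalize X - Xᵀ = K
    generalize Y - Yᵀ = J
    simp only [Matrix.mul_add, Matrix.add_mul, Matrix.mul_one, Matrix.one_mul]
    abel
  rw [h7, h4]
  abel

/-- A block-diagonal reference matrix `S` with separated blocks, perturbed by `E`: the distance of
`S + E` to the matrices of rank at most `r` agrees with the norm of the trailing block up to an
error of second order in the relative perturbation size. -/
theorem tail_perturbation {r : ℕ} {P : Matrix (Fin m) (Fin m) ℝ}
    {P' : Matrix (Fin n) (Fin n) ℝ} (hs : Pᵀ = P) (hi : P * P = P) (hs' : P'ᵀ = P')
    (hi' : P' * P' = P') (hr : frobNorm P ^ 2 = r) (hr' : frobNorm P' ^ 2 = r)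
    (hrk : P.rank ≤ r)
    {S E : Matrix (Fin m) (Fin n) ℝ} {T : Matrix (Fin n) (Fin m) ℝ} (hST : S * T = P)
    (hTS : T * S = P') (hPS : P * S = S * P') {a b τ : ℝ} (ha : 0 < a) (hab : b < a)
    (hT : a * specNorm T ≤ 1) (hb : specNorm ((1 - P) * S) ≤ b)
    (hτ : 0 ≤ τ) (hτ' : τ ≤ 1 / 2) (hE : specNorm E ≤ τ * (a - b))
    {X : Matrix (Fin m) (Fin m) ℝ} {Y : Matrix (Fin n) (Fin n) ℝ}
    (hPX : P * X = X) (hXP : X * P = 0) (hPY : P' * Y = Y) (hYP : Y * P' = 0)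
    (h1 : X * S + S * Y = -(P * E * (1 - P')))
    (h2 : Sᵀ * X + Y * Sᵀ = P' * Eᵀ * (1 - P)) :
    (∃ Q : Matrix (Fin m) (Fin n) ℝ, Q.rank ≤ r ∧ frobNorm (S + E - Q) ≤
        frobNorm ((1 - P) * (S + E) * (1 - P')) + 12 * τ ^ 2 * frobNorm (S + E)) ∧
      ∀ Q : Matrix (Fin m) (Fin n) ℝ, Q.rank ≤ r →
        frobNorm ((1 - P) * (S + E) * (1 - P')) ≤
          (1 + 4 * τ ^ 2) * frobNorm (S + E - Q) + 12 * τ ^ 2 * frobNorm (S + E) := by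
  have hd : 0 < a - b := sub_pos.2 hab
  have hb0 : 0 ≤ b := (specNorm_nonneg _).trans hb
  have hsP : specNorm P ≤ 1 := specNorm_proj_le hs hi
  have hsP' : specNorm P' ≤ 1 := specNorm_proj_le hs' hi'
  have hcs : specNorm (1 - P) ≤ 1 :=
    specNorm_proj_le (by rw [Matrix.transpose_sub, hs, Matrix.transpose_one]) (one_sub_idem hi)
  have hcs' : specNorm (1 - P') ≤ 1 :=
    specNorm_proj_le (by rw [Matrix.transpose_sub, hs', Matrix.transpose_one]) (one_sub_idem hi')
  have sandwich : ∀ {i j : ℕ} (B : Matrix (Fin i) (Fin i) ℝ) (Z : Matrix (Fin i) (Fin j) ℝ)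
      (C : Matrix (Fin j) (Fin j) ℝ), specNorm B ≤ 1 → specNorm C ≤ 1 →
      specNorm (B * Z * C) ≤ specNorm Z := by
    intro i j B Z C hB hC
    calc specNorm (B * Z * C) ≤ specNorm (B * Z) * specNorm C := specNorm_mul_le _ _
      _ ≤ specNorm (B * Z) * 1 := mul_le_mul_of_nonneg_left hC (specNorm_nonneg _)
      _ ≤ specNorm B * specNorm Z := by rw [mul_one]; exact specNorm_mul_le _ _
      _ ≤ 1 * specNorm Z := mul_le_mul_of_nonneg_right hB (specNorm_nonneg _)
      _ = _ := one_mul _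
  obtain ⟨hX, hY⟩ := specNorm_sylvester_le hs hs' hST hTS hPS ha hab hT hb
    ((sandwich _ _ _ hsP hcs').trans hE)
    ((sandwich _ _ _ hsP' hcs).trans (by rwa [specNorm_transpose])) hPX hXP hPY hYP h1 h2
  rw [mul_div_cancel_right₀ _ hd.ne'] at hX hY
  have hLGR := one_add_mul_mul_one_add_eq hi hs hs' hPS h1 h2
  set K := X - Xᵀ with hKdef
  set J := Y - Yᵀ with hJdef
  have hK : Kᵀ = -K := by simp [hKdef]
  have hJ : Jᵀ = -J := by simp [hJdef]
  have hK2 : specNorm K ≤ 2 * τ := by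
    have := specNorm_sub_le X Xᵀ
    rw [specNorm_transpose] at this
    linarith
  have hJ2 : specNorm J ≤ 2 * τ := by
    have := specNorm_sub_le Y Yᵀ
    rw [specNorm_transpose] at this
    linarith
  set G := S + E with hG
  set N := frobNorm G with hN
  have hN0 : 0 ≤ N := frobNorm_nonneg _
  have hp0 : 0 ≤ frobNorm P := frobNorm_nonneg _
  have hpp : frobNorm P' = frobNorm P := by
    rw [← sq_eq_sq₀ (frobNorm_nonneg _) hp0, hr, hr']
  have hE2 : specNorm E ≤ (a - b) / 2 := hE.trans (by nlinarith)
  have hlow : ∀ B : Matrix (Fin m) (Fin m) ℝ, a * frobNorm (B * P) ≤ frobNorm (B * P * S) := by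
    intro B
    have e : B * P = B * P * S * T := by
      rw [Matrix.mul_assoc (B * P), hST, Matrix.mul_assoc, hi]
    have h := frobNorm_mul_le (B * P * S) T
    rw [← e] at h
    calc a * frobNorm (B * P) ≤ a * (frobNorm (B * P * S) * specNorm T) :=
          mul_le_mul_of_nonneg_left h ha.le
      _ = frobNorm (B * P * S) * (a * specNorm T) := by ring
      _ ≤ frobNorm (B * P * S) * 1 := mul_le_mul_of_nonneg_left hT (frobNorm_nonneg _)
      _ = _ := mul_one _
  -- Here `‖P‖_F = √r`. This inequality absorbs the rank into `‖S + E‖_F`, since `E` costs at most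
  -- half of the gap.
  have hpN : frobNorm P * (a - b) ≤ 2 * N := by
    have e1 := hlow 1
    rw [Matrix.one_mul] at e1
    have e2 : P * S = P * G - P * E := by rw [hG, Matrix.mul_add, add_sub_cancel_right]
    rw [e2] at e1
    have e3 := frobNorm_sub_le (P * G) (P * E)
    have e4 : frobNorm (P * G) ≤ N := frobNorm_proj_mul_le hs hi G
    have e5 := frobNorm_mul_le P E
    have e6 := mul_le_mul_of_nonneg_left hE2 hp0
    have e7 : 0 ≤ frobNorm P * b := mul_nonneg hp0 hb0
    nlinarith
  -- `X = PX` has rank at most `r`, which turns its spectral bound into a Frobenius bound with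
  -- factor `√r`.
  have hKF : frobNorm K ≤ 2 * (frobNorm P * τ) := by
    have e := frobNorm_sub_le X Xᵀ
    rw [frobNorm_transpose] at e
    have e2 := frobNorm_mul_le P X
    rw [hPX] at e2
    have e3 := mul_le_mul_of_nonneg_left hX hp0
    linarith
  have hJF : frobNorm J ≤ 2 * (frobNorm P * τ) := by
    have e := frobNorm_sub_le Y Yᵀ
    rw [frobNorm_transpose] at e
    have e2 := frobNorm_mul_le P' Y
    rw [hPY, hpp] at e2
    have e3 := mul_le_mul_of_nonneg_left hY hp0
    linarith
  have hτp : 2 * (frobNorm P * τ) * (τ * (a - b)) ≤ 4 * τ ^ 2 * N := by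
    have := mul_le_mul_of_nonneg_left hpN (mul_nonneg zero_le_two (sq_nonneg τ))
    linarith
  have hpt : 0 ≤ 2 * (frobNorm P * τ) := mul_nonneg zero_le_two (mul_nonneg hp0 hτ)
  set R := K * E + E * J + K * G * J with hR
  -- Each of the three terms of `R` contributes `4τ²N`.
  have hRN : frobNorm R ≤ 12 * τ ^ 2 * N := by
    have e1 : frobNorm (K * E) ≤ 4 * τ ^ 2 * N :=
      (frobNorm_mul_le _ _).trans ((mul_le_mul hKF hE (specNorm_nonneg _) hpt).trans hτp)
    have e2 : frobNorm (E * J) ≤ 4 * τ ^ 2 * N := by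
      refine (frobNorm_mul_le' _ _).trans ?_
      rw [mul_comm]
      exact (mul_le_mul hJF hE (specNorm_nonneg _) hpt).trans hτp
    have e3 : frobNorm (K * G * J) ≤ 4 * τ ^ 2 * N := by
      calc frobNorm (K * G * J) ≤ frobNorm (K * G) * specNorm J := frobNorm_mul_le _ _
        _ ≤ (specNorm K * N) * specNorm J :=
            mul_le_mul_of_nonneg_right (frobNorm_mul_le' _ _) (specNorm_nonneg _)
        _ ≤ (2 * τ * N) * (2 * τ) := mul_le_mul (mul_le_mul_of_nonneg_right hK2 hN0) hJ2
            (specNorm_nonneg _) (mul_nonneg (by linarith) hN0)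
        _ = 4 * τ ^ 2 * N := by ring
    have e4 := frobNorm_add_le (K * E + E * J) (K * G * J)
    have e5 := frobNorm_add_le (K * E) (E * J)
    linarith
  set F := (1 - P) * G * (1 - P') with hF
  set A := P * G * P' with hA
  constructor
  -- The leading block pulled back through the near-rotation. Undoing the rotation does not increase
  -- the error `F + R`.
  · refine ⟨(1 + K)⁻¹ * A * (1 + J)⁻¹, ?_, ?_⟩
    · refine (Matrix.rank_mul_le_left _ _).trans ((Matrix.rank_mul_le_right _ _).trans ?_)
      rw [hA, Matrix.mul_assoc]
      exact (Matrix.rank_mul_le_left _ _).trans hrk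
    · have e : (1 + K) * (G - (1 + K)⁻¹ * A * (1 + J)⁻¹) * (1 + J) = F + R := by
        rw [Matrix.mul_sub, Matrix.sub_mul, hLGR, Matrix.mul_assoc _ A, ← Matrix.mul_assoc (1 + K),
          Matrix.mul_nonsing_inv _ (isUnit_det_one_add_skew hK), Matrix.one_mul, Matrix.mul_assoc A,
          Matrix.nonsing_inv_mul _ (isUnit_det_one_add_skew hJ), Matrix.mul_one]
        abel
      have e1 := frobNorm_le_one_add_skew_mul hK (G - (1 + K)⁻¹ * A * (1 + J)⁻¹)
      have e2 := frobNorm_le_mul_one_add_skew hJ ((1 + K) * (G - (1 + K)⁻¹ * A * (1 + J)⁻¹))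
      rw [e] at e2
      have e3 := frobNorm_add_le F R
      linarith
  · intro Q hQ
    -- The threshold between the blocks: `A` stretches by at least `a - ‖E‖`, and `‖F‖ ≤ b + ‖E‖ ≤ a
    -- - ‖E‖` because `‖E‖ ≤ (a - b) / 2`.
    have hc : 0 ≤ a - specNorm E := by linarith
    have hAc : ∀ B : Matrix (Fin m) (Fin m) ℝ,
        (a - specNorm E) * frobNorm (B * P) ≤ frobNorm (B * A) := by
      intro B
      have e : B * P * S = B * A - B * P * (E * P') := by
        rw [hA, hG, Matrix.mul_add, Matrix.add_mul, hPS, Matrix.mul_assoc S, hi', ← hPS,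
          Matrix.mul_add, ← Matrix.mul_assoc, Matrix.mul_assoc P E, ← Matrix.mul_assoc B P,
          add_sub_cancel_right]
      have e1 := hlow B
      rw [e] at e1
      have e2 := frobNorm_sub_le (B * A) (B * P * (E * P'))
      have e3 := frobNorm_mul_le (B * P) (E * P')
      have e4 : specNorm (E * P') ≤ specNorm E := by
        simpa using sandwich 1 E P' specNorm_one_le hsP'
      have e5 := mul_le_mul_of_nonneg_left e4 (frobNorm_nonneg (B * P))
      linarith
    have hFc : specNorm F ≤ a - specNorm E := by
      have e : F = (1 - P) * S + (1 - P) * E * (1 - P') := by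
        have h5 : P * S * P' = P * S := by rw [Matrix.mul_assoc, ← hPS, ← Matrix.mul_assoc, hi]
        rw [hF, hG, Matrix.mul_add, Matrix.add_mul, Matrix.mul_sub ((1 - P) * S), Matrix.mul_one,
          Matrix.sub_mul, Matrix.one_mul, Matrix.sub_mul S, h5, ← hPS, sub_self, sub_zero]
      rw [e]
      have e1 := specNorm_add_le ((1 - P) * S) ((1 - P) * E * (1 - P'))
      have e2 := sandwich _ E _ hcs hcs'
      linarith
    have hEY := frobNorm_le_frobNorm_add_sub hs hi hs' hi' hr (A := A) (F := F)
      (Q := (1 + K) * Q * (1 + J)) (by rw [hA, Matrix.mul_assoc, hi'])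
      (by rw [hF, Matrix.mul_assoc, Matrix.sub_mul 1 P' P', hi', Matrix.one_mul, sub_self,
            Matrix.mul_zero])
      (by rw [hF, ← Matrix.mul_assoc, ← Matrix.mul_assoc, Matrix.mul_sub P 1 P, hi, Matrix.mul_one,
            sub_self, Matrix.zero_mul, Matrix.zero_mul])
      hc hAc hFc
      ((Matrix.rank_mul_le_left _ _).trans ((Matrix.rank_mul_le_right _ _).trans hQ))
    have e : A + F - (1 + K) * Q * (1 + J) = (1 + K) * (G - Q) * (1 + J) - R := by
      rw [Matrix.mul_sub, Matrix.sub_mul, hLGR]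
      abel
    rw [e] at hEY
    have e1 := frobNorm_sub_le ((1 + K) * (G - Q) * (1 + J)) R
    have e2 : frobNorm ((1 + K) * (G - Q) * (1 + J)) ≤
        specNorm (1 + K) * specNorm (1 + J) * frobNorm (G - Q) := by
      refine (frobNorm_mul_le _ _).trans ?_
      have := mul_le_mul_of_nonneg_right (frobNorm_mul_le' (1 + K) (G - Q))
        (specNorm_nonneg (1 + J))
      linarith
    -- The product is at most the mean of the squares, each at most `1 + (2τ)²`.
    have e3 : specNorm (1 + K) * specNorm (1 + J) ≤ 1 + 4 * τ ^ 2 := by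
      have k1 := specNorm_one_add_skew_sq_le hK
      have k2 := specNorm_one_add_skew_sq_le hJ
      have k3 := pow_le_pow_left₀ (specNorm_nonneg _) hK2 2
      have k4 := pow_le_pow_left₀ (specNorm_nonneg _) hJ2 2
      have k5 := two_mul_le_add_sq (specNorm (1 + K)) (specNorm (1 + J))
      linarith
    have e4 := mul_le_mul_of_nonneg_right e3 (frobNorm_nonneg (G - Q))
    linarith

/-! ### Rectangular diagonal matrices -/

/-- The rectangular diagonal matrix with diagonal entries `d 0, d 1, …`. -/
def rectDiag (m n : ℕ) (d : ℕ → ℝ) : Matrix (Fin m) (Fin n) ℝ :=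
  Matrix.of fun i j => if (i : ℕ) = (j : ℕ) then d i else 0

theorem rectDiag_congr {d e : ℕ → ℝ} (h : ∀ i, i < m → i < n → d i = e i) :
    rectDiag m n d = rectDiag m n e := by
  ext i j
  simp only [rectDiag, Matrix.of_apply]
  split_ifs with hij
  · exact h i i.2 (hij ▸ j.2)
  · rfl

theorem rectDiag_eq_diagonal (d : ℕ → ℝ) : rectDiag m m d = diagonal fun i : Fin m => d i := by
  ext i j
  simp [rectDiag, Matrix.diagonal_apply, Fin.ext_iff]

theorem transpose_rectDiag (d : ℕ → ℝ) : (rectDiag m n d)ᵀ = rectDiag n m d := by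
  ext i j
  simp only [rectDiag, Matrix.of_apply, Matrix.transpose_apply, eq_comm (a := (i : ℕ))]
  split_ifs with h
  · rw [h]
  · rfl

theorem rectDiag_mul_apply (d : ℕ → ℝ) (A : Matrix (Fin m) (Fin n) ℝ) (i : Fin l) (j : Fin n) :
    (rectDiag l m d * A) i j = if h : (i : ℕ) < m then d i * A ⟨i, h⟩ j else 0 := by
  simp only [Matrix.mul_apply, rectDiag, Matrix.of_apply, ite_mul, zero_mul]
  split_ifs with h
  · rw [Finset.sum_eq_single ⟨i, h⟩] <;> simp +contextual [Fin.ext_iff, eq_comm]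
  · exact Finset.sum_eq_zero fun k _ => if_neg fun hk : (i : ℕ) = k => h (hk ▸ k.2)

theorem mul_rectDiag_apply (d : ℕ → ℝ) (A : Matrix (Fin l) (Fin m) ℝ) (i : Fin l) (j : Fin n) :
    (A * rectDiag m n d) i j = if h : (j : ℕ) < m then A i ⟨j, h⟩ * d j else 0 := by
  have := rectDiag_mul_apply d Aᵀ j i
  rw [← transpose_rectDiag, ← Matrix.transpose_mul] at this
  simpa [mul_comm] using this

theorem rectDiag_mul_rectDiag (d e : ℕ → ℝ) :
    rectDiag l m d * rectDiag m n e = rectDiag l n fun i => if i < m then d i * e i else 0 := by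
  ext i j
  rw [rectDiag_mul_apply]
  simp only [rectDiag, Matrix.of_apply]
  split_ifs <;> simp

theorem one_sub_rectDiag (d : ℕ → ℝ) : 1 - rectDiag m m d = rectDiag m m fun i => 1 - d i := by
  rw [rectDiag_eq_diagonal, rectDiag_eq_diagonal, ← Matrix.diagonal_one, Matrix.diagonal_sub]

theorem specNorm_rectDiag_le {d : ℕ → ℝ} {c : ℝ} (hc : 0 ≤ c) (h : ∀ i, i < m → |d i| ≤ c) :
    specNorm (rectDiag m n d) ≤ c := by
  refine le_of_sq_le_sq ?_ hc
  rw [specNorm_sq, transpose_rectDiag, rectDiag_mul_rectDiag, rectDiag_eq_diagonal]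
  refine specNorm_diagonal_le _ (sq_nonneg c) fun i => ?_
  split_ifs with hi
  · rw [abs_mul, ← sq]
    exact pow_le_pow_left₀ (abs_nonneg _) (h i hi) 2
  · simpa using sq_nonneg c

/-- The projection onto the span of the first `r` coordinate vectors. -/
def coordProj (m r : ℕ) : Matrix (Fin m) (Fin m) ℝ :=
  rectDiag m m fun i => if i < r then 1 else 0

theorem transpose_coordProj (r : ℕ) : (coordProj m r)ᵀ = coordProj m r := transpose_rectDiag _

theorem coordProj_mul_self (r : ℕ) : coordProj m r * coordProj m r = coordProj m r := by
  rw [coordProj, rectDiag_mul_rectDiag]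
  refine rectDiag_congr fun i hi _ => ?_
  simp [hi]

theorem frobNorm_coordProj_sq {r : ℕ} (h : r ≤ m) : frobNorm (coordProj m r) ^ 2 = r := by
  rw [frobNorm_sq_eq_trace, transpose_coordProj, coordProj_mul_self, coordProj,
    rectDiag_eq_diagonal, Matrix.trace_diagonal, Fin.sum_univ_eq_sum_range
      (fun i => if i < r then (1 : ℝ) else 0), Finset.sum_ite]
  have : (Finset.range m).filter (· < r) = Finset.range r := by
    ext i; simp only [Finset.mem_filter, Finset.mem_range]; omega
  simp [this]

/-- The projection factors through a space of dimension `r`; this needs no comparison of `r` with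
`m`. -/
theorem rank_coordProj_le (r : ℕ) : (coordProj m r).rank ≤ r := by
  have : coordProj m r = rectDiag m r 1 * rectDiag r m 1 := by
    rw [rectDiag_mul_rectDiag, coordProj]
    simp
  rw [this]
  exact (Matrix.rank_mul_le_left _ _).trans (Matrix.rank_le_width _)

theorem complProj_eq {U : Matrix (Fin m) (Fin m) ℝ} (hU : U ∈ Matrix.orthogonalGroup (Fin m) ℝ)
    (r : ℕ) : complProj U r = U * (1 - coordProj m r) * Uᵀ := by
  have h1 : U * Uᵀ = 1 := (Matrix.mem_orthogonalGroup_iff _ _).1 hU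
  have h2 : leadingCols U r * (leadingCols U r)ᵀ = U * coordProj m r * Uᵀ := by
    ext i j
    rw [coordProj, rectDiag_eq_diagonal, Matrix.mul_apply, Matrix.mul_apply]
    simp only [Matrix.mul_diagonal, Matrix.transpose_apply, leadingCols, Matrix.submatrix_apply,
      id, mul_ite, mul_one, mul_zero, ite_mul, zero_mul]
    rw [← Finset.sum_filter]
    exact (Finset.sum_subtype _ (by simp) fun k => U i k * U j k).symm
  rw [complProj, h2, Matrix.mul_sub, Matrix.sub_mul, Matrix.mul_one, h1]

/-! ### The estimate for a diagonal reference matrix -/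

/-- Second-order perturbation of the tail of a rectangular diagonal matrix with decreasing
diagonal. -/
theorem tail_perturbation_rectDiag {r : ℕ} (hr0 : 1 ≤ r) (hrm : r ≤ m) (hrn : r ≤ n)
    {s : ℕ → ℝ} (hs : Antitone s) (hs0 : ∀ i, 0 ≤ s i) (hsz : ∀ i, m ≤ i ∨ n ≤ i → s i = 0)
    (hgap : s r < s (r - 1)) {τ : ℝ} (hτ : 0 ≤ τ) (hτ' : τ ≤ 1 / 2)
    {E : Matrix (Fin m) (Fin n) ℝ} (hE : specNorm E ≤ τ * (s (r - 1) - s r)) :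
    (∃ Q : Matrix (Fin m) (Fin n) ℝ, Q.rank ≤ r ∧ frobNorm (rectDiag m n s + E - Q) ≤
        frobNorm ((1 - coordProj m r) * (rectDiag m n s + E) * (1 - coordProj n r)) +
          12 * τ ^ 2 * frobNorm (rectDiag m n s + E)) ∧
      ∀ Q : Matrix (Fin m) (Fin n) ℝ, Q.rank ≤ r →
        frobNorm ((1 - coordProj m r) * (rectDiag m n s + E) * (1 - coordProj n r)) ≤
          (1 + 4 * τ ^ 2) * frobNorm (rectDiag m n s + E - Q) +
            12 * τ ^ 2 * frobNorm (rectDiag m n s + E) := by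
  have ha : 0 < s (r - 1) := (hs0 r).trans_lt hgap
  have hbig : ∀ i, i < r → s (r - 1) ≤ s i := fun i hi => hs (by omega)
  have hpos : ∀ i, i < r → 0 < s i := fun i hi => ha.trans_le (hbig i hi)
  -- Extension of `E` by zero: `X` is `m × m` and `Y` is `n × n`, so their formulas also meet
  -- indices outside `E`.
  let e : ℕ → ℕ → ℝ := fun i j => if h : i < m ∧ j < n then E ⟨i, h.1⟩ ⟨j, h.2⟩ else 0
  have he : ∀ (i : Fin m) (j : Fin n), E i j = e i j := fun i j => by simp [e]
  -- For diagonal `S` the Sylvester equations decouple into a 2 × 2 system for each pair `(i, j)`.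
  -- Cramer's rule gives `x` and `y`, and the gap makes the denominator nonzero.
  let x : ℕ → ℕ → ℝ := fun i j =>
    if i < r ∧ r ≤ j then (s i * e j i + s j * e i j) / (s i ^ 2 - s j ^ 2) else 0
  let y : ℕ → ℕ → ℝ := fun i j =>
    if i < r ∧ r ≤ j then -(s i * e i j + s j * e j i) / (s i ^ 2 - s j ^ 2) else 0
  have hx0 : ∀ i j, ¬ (i < r ∧ r ≤ j) → x i j = 0 := fun i j h => if_neg h
  have hy0 : ∀ i j, ¬ (i < r ∧ r ≤ j) → y i j = 0 := fun i j h => if_neg h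
  have hden : ∀ i j, i < r → r ≤ j → s i ^ 2 - s j ^ 2 ≠ 0 := by
    intro i j hi hj
    have : s j < s i := (hs hj).trans_lt (hgap.trans_le (hbig i hi))
    have := pow_lt_pow_left₀ this (hs0 j) two_ne_zero
    exact (sub_pos.2 this).ne'
  have hsyl : ∀ i j, x i j * s j + s i * y i j = if i < r ∧ r ≤ j then -e i j else 0 := by
    intro i j
    simp only [x, y]
    split_ifs with h
    · have := hden i j h.1 h.2
      field_simp
      ring
    · simp
  have hsyl' : ∀ i j, s i * x i j + y i j * s j = if i < r ∧ r ≤ j then e j i else 0 := by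
    intro i j
    simp only [x, y]
    split_ifs with h
    · have := hden i j h.1 h.2
      field_simp
      ring
    · simp
  refine tail_perturbation (transpose_coordProj r) (coordProj_mul_self r) (transpose_coordProj r)
    (coordProj_mul_self r) (frobNorm_coordProj_sq hrm) (frobNorm_coordProj_sq hrn)
    (rank_coordProj_le r) (T := rectDiag n m fun i => if i < r then (s i)⁻¹ else 0)
    ?_ ?_ ?_ ha hgap ?_ ?_ hτ hτ' hE (X := Matrix.of fun i j => x i j)
    (Y := Matrix.of fun i j => y i j) ?_ ?_ ?_ ?_ ?_ ?_
  · rw [rectDiag_mul_rectDiag, coordProj]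
    refine rectDiag_congr fun i _ _ => ?_
    by_cases h : i < r
    · simp [h, h.trans_le hrn, (hpos i h).ne']
    · simp [h]
  · rw [rectDiag_mul_rectDiag, coordProj]
    refine rectDiag_congr fun i _ _ => ?_
    by_cases h : i < r
    · simp [h, h.trans_le hrm, (hpos i h).ne']
    · simp [h]
  · rw [coordProj, coordProj, rectDiag_mul_rectDiag, rectDiag_mul_rectDiag]
    refine rectDiag_congr fun i h h' => ?_
    simp [h, h']
  · have : specNorm (rectDiag n m fun i => if i < r then (s i)⁻¹ else 0) ≤ (s (r - 1))⁻¹ := by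
      refine specNorm_rectDiag_le (inv_nonneg.2 ha.le) fun i _ => ?_
      split_ifs with h
      · rw [abs_of_nonneg (inv_nonneg.2 (hs0 i))]
        exact inv_anti₀ ha (hbig i h)
      · simpa using ha.le
    calc _ ≤ s (r - 1) * (s (r - 1))⁻¹ := mul_le_mul_of_nonneg_left this ha.le
      _ = 1 := mul_inv_cancel₀ ha.ne'
  · rw [coordProj, one_sub_rectDiag, rectDiag_mul_rectDiag]
    refine specNorm_rectDiag_le (hs0 r) fun i h => ?_
    by_cases hi : i < r
    · simpa [hi] using hs0 r
    · simpa [hi, h, abs_of_nonneg (hs0 i)] using hs (not_lt.1 hi)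
  · ext i j
    rw [coordProj, rectDiag_eq_diagonal, Matrix.diagonal_mul, Matrix.of_apply]
    by_cases h : (i : ℕ) < r
    · simp [h]
    · simp [h, hx0 i j (by tauto)]
  · ext i j
    rw [coordProj, rectDiag_eq_diagonal, Matrix.mul_diagonal, Matrix.of_apply]
    by_cases h : (j : ℕ) < r
    · simp [hx0 i j (by omega)]
    · simp [h]
  · ext i j
    rw [coordProj, rectDiag_eq_diagonal, Matrix.diagonal_mul, Matrix.of_apply]
    by_cases h : (i : ℕ) < r
    · simp [h]
    · simp [h, hy0 i j (by tauto)]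
  · ext i j
    rw [coordProj, rectDiag_eq_diagonal, Matrix.mul_diagonal, Matrix.of_apply]
    by_cases h : (j : ℕ) < r
    · simp [hy0 i j (by omega)]
    · simp [h]
  · ext i j
    -- For `j ≥ m` the matrix `X` has no column `j`; the formula persists because `s j = 0`.
    have k1 : ((Matrix.of fun (i j : Fin m) => x i j) * rectDiag m n s) i j = x i j * s j := by
      rw [mul_rectDiag_apply]
      split_ifs with h
      · rfl
      · rw [hsz j (Or.inl (not_lt.1 h)), mul_zero]
    have k2 : (rectDiag m n s * Matrix.of fun (i j : Fin n) => y i j) i j = s i * y i j := by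
      rw [rectDiag_mul_apply]
      split_ifs with h
      · rfl
      · rw [hsz i (Or.inr (not_lt.1 h)), zero_mul]
    rw [Matrix.add_apply, k1, k2, hsyl, coordProj, coordProj, one_sub_rectDiag,
      rectDiag_eq_diagonal, rectDiag_eq_diagonal, Matrix.neg_apply, Matrix.mul_diagonal,
      Matrix.diagonal_mul, he]
    by_cases h : (i : ℕ) < r <;> by_cases h' : (j : ℕ) < r <;> simp [h, h', not_le.2, not_lt.1]
  · ext i j
    have k1 : ((rectDiag m n s)ᵀ * Matrix.of fun (i j : Fin m) => x i j) i j = s i * x i j := by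
      rw [transpose_rectDiag, rectDiag_mul_apply]
      split_ifs with h
      · rfl
      · rw [hsz i (Or.inl (not_lt.1 h)), zero_mul]
    have k2 : ((Matrix.of fun (i j : Fin n) => y i j) * (rectDiag m n s)ᵀ) i j = y i j * s j := by
      rw [transpose_rectDiag, mul_rectDiag_apply]
      split_ifs with h
      · rfl
      · rw [hsz j (Or.inr (not_lt.1 h)), mul_zero]
    rw [Matrix.add_apply, k1, k2, hsyl', coordProj, coordProj, one_sub_rectDiag,
      rectDiag_eq_diagonal, rectDiag_eq_diagonal, Matrix.mul_diagonal,
      Matrix.diagonal_mul, Matrix.transpose_apply, he]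
    by_cases h : (i : ℕ) < r <;> by_cases h' : (j : ℕ) < r <;> simp [h, h', not_le.2, not_lt.1]

/-! ### Orthogonal invariance and the tail energy -/

section Orthogonal

variable {U : Matrix (Fin m) (Fin m) ℝ} (hU : Uᵀ * U = 1)

include hU

theorem frobNorm_orthogonal_mul (A : Matrix (Fin m) (Fin n) ℝ) :
    frobNorm (U * A) = frobNorm A := by
  rw [← sq_eq_sq₀ (frobNorm_nonneg _) (frobNorm_nonneg _), frobNorm_sq_eq_trace',
    frobNorm_sq_eq_trace', Matrix.transpose_mul, Matrix.mul_assoc, ← Matrix.mul_assoc Uᵀ, hU,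
    Matrix.one_mul]

theorem frobNorm_mul_orthogonal_transpose (A : Matrix (Fin n) (Fin m) ℝ) :
    frobNorm (A * Uᵀ) = frobNorm A := by
  rw [← frobNorm_transpose, Matrix.transpose_mul, Matrix.transpose_transpose,
    frobNorm_orthogonal_mul hU, frobNorm_transpose]

theorem specNorm_orthogonal_le : specNorm U ≤ 1 := by
  refine le_of_sq_le_sq ?_ zero_le_one
  rw [specNorm_sq, hU, one_pow]
  exact specNorm_one_le

end Orthogonal

theorem sqrt_tailEnergy_le {r : ℕ} (G : Matrix (Fin m) (Fin n) ℝ) {Q : Matrix (Fin m) (Fin n) ℝ}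
    (hQ : Q.rank ≤ r) : Real.sqrt (tailEnergy r G) ≤ frobNorm (G - Q) := by
  refine Real.sqrt_le_iff.2 ⟨frobNorm_nonneg _, ?_⟩
  exact ciInf_le (f := fun Q : {Q : Matrix (Fin m) (Fin n) ℝ // Q.rank ≤ r} =>
    frobNorm (G - Q.1) ^ 2) ⟨0, by rintro _ ⟨Q, rfl⟩; exact sq_nonneg _⟩ ⟨Q, hQ⟩

/-- A bound against every competitor passes to the infimum, so no minimiser has to be exhibited. -/
theorem le_sqrt_tailEnergy {r : ℕ} {G : Matrix (Fin m) (Fin n) ℝ} {c : ℝ}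
    (h : ∀ Q : Matrix (Fin m) (Fin n) ℝ, Q.rank ≤ r → c ≤ frobNorm (G - Q)) :
    c ≤ Real.sqrt (tailEnergy r G) := by
  rcases le_total c 0 with hc | hc
  · exact hc.trans (Real.sqrt_nonneg _)
  · refine Real.le_sqrt_of_sq_le ?_
    have : Nonempty {Q : Matrix (Fin m) (Fin n) ℝ // Q.rank ≤ r} := ⟨⟨0, by simp⟩⟩
    exact le_ciInf fun Q => pow_le_pow_left₀ hc (h Q.1 Q.2) 2

/-- The singular values are cut off at `min m n`, so their vanishing beyond it holds by
construction; the matrix only sees smaller indices. -/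
theorem exists_sigmaMatrix_eq_rectDiag (S : Matrix (Fin m) (Fin n) ℝ) :
    ∃ s : ℕ → ℝ, Antitone s ∧ (∀ i, 0 ≤ s i) ∧ (∀ i, m ≤ i ∨ n ≤ i → s i = 0) ∧
      (∀ i, i < min m n → s i = singVal S i) ∧ sigmaMatrix S = rectDiag m n s := by
  have h0 : ∀ i, 0 ≤ singVal S i := fun i => LinearMap.singularValues_nonneg _ i
  refine ⟨fun i => if i < min m n then singVal S i else 0, ?_, ?_, ?_, ?_, ?_⟩
  · intro i j hij
    dsimp only
    split_ifs with h1 h2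
    · exact LinearMap.singularValues_antitone _ hij
    · omega
    · exact h0 i
    · exact le_rfl
  · intro i
    dsimp only
    split_ifs
    exacts [h0 i, le_rfl]
  · intro i hi
    exact if_neg (by omega)
  · intro i hi
    exact if_pos hi
  · exact rectDiag_congr (d := singVal S) fun i h h' => (if_pos (lt_min h h')).symm

theorem abs_sqrt_tailEnergy_sub_le {r : ℕ} (hr : 1 ≤ r) (hrmn : r < min m n)
    {S E : Matrix (Fin m) (Fin n) ℝ} {U : Matrix (Fin m) (Fin m) ℝ} {V : Matrix (Fin n) (Fin n) ℝ}
    (hSVD : IsSVD S U V) (hgap : 0 < spectralGap r S) {τ : ℝ} (hτ : 0 ≤ τ) (hτ' : τ ≤ 1 / 2)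
    (hE : specNorm E ≤ τ * spectralGap r S) :
    |Real.sqrt (tailEnergy r (S + E)) - frobNorm (complProj U r * (S + E) * complProj V r)| ≤
      16 * τ ^ 2 * frobNorm (S + E) := by
  have hU : Uᵀ * U = 1 := (Matrix.mem_orthogonalGroup_iff' _ _).1 hSVD.left_orthogonal
  have hV : Vᵀ * V = 1 := (Matrix.mem_orthogonalGroup_iff' _ _).1 hSVD.right_orthogonal
  have hU' : U * Uᵀ = 1 := (Matrix.mem_orthogonalGroup_iff _ _).1 hSVD.left_orthogonal
  have hV' : V * Vᵀ = 1 := (Matrix.mem_orthogonalGroup_iff _ _).1 hSVD.right_orthogonal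
  obtain ⟨s, hs, hs0, hsz, hsS, hsigma⟩ := exists_sigmaMatrix_eq_rectDiag S
  -- Both indices lie below `min m n`, so the cut-off leaves the gap unchanged.
  have hδ : spectralGap r S = s (r - 1) - s r := by
    rw [spectralGap, hsS _ hrmn, hsS _ (by omega)]
  rw [hδ] at hgap hE
  have hE' : specNorm (Uᵀ * E * V) ≤ τ * (s (r - 1) - s r) := by
    refine le_trans ?_ hE
    have hU1 : specNorm Uᵀ ≤ 1 := by rw [specNorm_transpose]; exact specNorm_orthogonal_le hU
    calc specNorm (Uᵀ * E * V) ≤ specNorm (Uᵀ * E) * specNorm V := specNorm_mul_le _ _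
      _ ≤ specNorm (Uᵀ * E) * 1 :=
          mul_le_mul_of_nonneg_left (specNorm_orthogonal_le hV) (specNorm_nonneg _)
      _ ≤ specNorm Uᵀ * specNorm E := by rw [mul_one]; exact specNorm_mul_le _ _
      _ ≤ 1 * specNorm E := mul_le_mul_of_nonneg_right hU1 (specNorm_nonneg _)
      _ = _ := one_mul _
  have hmn := lt_min_iff.1 hrmn
  obtain ⟨⟨Q₀, hQ₀, hup⟩, hlow⟩ := tail_perturbation_rectDiag hr hmn.1.le hmn.2.le hs hs0 hsz
    (sub_pos.1 hgap) hτ hτ' hE'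
  set G' := rectDiag m n s + Uᵀ * E * V with hG'
  have hG : S + E = U * G' * Vᵀ := by
    have e : U * (Uᵀ * E * V) * Vᵀ = U * Uᵀ * E * (V * Vᵀ) := by simp only [Matrix.mul_assoc]
    rw [hG', Matrix.mul_add, Matrix.add_mul, ← hsigma, ← hSVD.eq_mul, e, hU', hV', Matrix.one_mul,
      Matrix.mul_one]
  have hinv : ∀ A : Matrix (Fin m) (Fin n) ℝ, frobNorm (U * A * Vᵀ) = frobNorm A := fun A => by
    rw [frobNorm_mul_orthogonal_transpose hV, frobNorm_orthogonal_mul hU]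
  have hF : frobNorm (complProj U r * (S + E) * complProj V r) =
      frobNorm ((1 - coordProj m r) * G' * (1 - coordProj n r)) := by
    rw [complProj_eq hSVD.left_orthogonal, complProj_eq hSVD.right_orthogonal, hG]
    have e : U * (1 - coordProj m r) * Uᵀ * (U * G' * Vᵀ) * (V * (1 - coordProj n r) * Vᵀ) =
        U * ((1 - coordProj m r) * (Uᵀ * U) * G' * (Vᵀ * V) * (1 - coordProj n r)) * Vᵀ := by
      simp only [Matrix.mul_assoc]
    rw [e, hinv, hU, hV, Matrix.mul_one, Matrix.mul_one]
  have hN : frobNorm (S + E) = frobNorm G' := by rw [hG, hinv]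
  rw [hF, hN]
  set f := frobNorm ((1 - coordProj m r) * G' * (1 - coordProj n r))
  have hrank : ∀ (A : Matrix (Fin m) (Fin m) ℝ) (Q : Matrix (Fin m) (Fin n) ℝ)
      (B : Matrix (Fin n) (Fin n) ℝ), Q.rank ≤ r → (A * Q * B).rank ≤ r := fun A Q B h =>
    (Matrix.rank_mul_le_left _ _).trans ((Matrix.rank_mul_le_right _ _).trans h)
  have h1 : Real.sqrt (tailEnergy r (S + E)) ≤ f + 12 * τ ^ 2 * frobNorm G' := by
    refine (sqrt_tailEnergy_le _ (hrank U Q₀ Vᵀ hQ₀)).trans ?_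
    rwa [hG, ← Matrix.sub_mul, ← Matrix.mul_sub, hinv]
  -- The competitor `Q = 0`.
  have h2 : Real.sqrt (tailEnergy r (S + E)) ≤ frobNorm G' := by
    simpa [hN] using sqrt_tailEnergy_le (r := r) (S + E) (Q := 0) (by simp)
  have hpos : 0 < 1 + 4 * τ ^ 2 := by positivity
  have h3 : (f - 12 * τ ^ 2 * frobNorm G') / (1 + 4 * τ ^ 2) ≤
      Real.sqrt (tailEnergy r (S + E)) := by
    refine le_sqrt_tailEnergy fun Q hQ => ?_
    have h := hlow (Uᵀ * Q * V) (hrank _ Q _ hQ)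
    have e : S + E - Q = U * (G' - Uᵀ * Q * V) * Vᵀ := by
      have e : U * (Uᵀ * Q * V) * Vᵀ = U * Uᵀ * Q * (V * Vᵀ) := by simp only [Matrix.mul_assoc]
      rw [Matrix.mul_sub, Matrix.sub_mul, ← hG, e, hU', hV', Matrix.one_mul, Matrix.mul_one]
    rw [e, hinv, div_le_iff₀' hpos]
    linarith
  rw [div_le_iff₀ hpos] at h3
  -- The stretching error `4τ²√E` is at most `4τ²‖G'‖_F`; added to `12τ²‖G'‖_F` it gives the
  -- constant 16.
  have h4 := mul_le_mul_of_nonneg_left h2 (mul_nonneg zero_le_four (sq_nonneg τ))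
  have h5 : 0 ≤ τ ^ 2 * frobNorm G' := mul_nonneg (sq_nonneg τ) (frobNorm_nonneg _)
  rw [abs_le]
  constructor <;> linarith

end FSFOA

theorem mainTheorem4 :
    ∃ τ₀ : ℝ, 0 < τ₀ ∧ τ₀ < 1 ∧ ∃ C' : ℝ, 0 < C' ∧
      ∀ (m n r : ℕ), 1 ≤ r → r < min m n →
      ∀ (S D : Matrix (Fin m) (Fin n) ℝ)
        (U : Matrix (Fin m) (Fin m) ℝ) (V : Matrix (Fin n) (Fin n) ℝ),
        FSFOA.IsSVD S U V →
        0 < FSFOA.spectralGap r S →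
        ∀ β : ℝ, 0 ≤ β → β ≤ 1 →
          FSFOA.relPert r S D β ≤ τ₀ →
          |FSFOA.tailRatio r S D β - FSFOA.surrogateRatio r S D U V β|
              ≤ C' * FSFOA.relPert r S D β ^ 2 ∧
          |FSFOA.tailRatio r S D β - FSFOA.surrogateRatio r S D U V β|
              ≤ C' * (β ^ 2 * FSFOA.specNorm D ^ 2 / FSFOA.spectralGap r S ^ 2) := by
  refine ⟨1 / 2, by norm_num, by norm_num, 16, by norm_num, ?_⟩
  intro m n r hr hrmn S D U V hSVD hgap β hβ _ hτ
  have hsq : FSFOA.relPert r S D β ^ 2 =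
      β ^ 2 * FSFOA.specNorm D ^ 2 / FSFOA.spectralGap r S ^ 2 := by
    rw [FSFOA.relPert, div_pow, mul_pow]
  rw [← hsq, and_self]
  have hτ0 : 0 ≤ FSFOA.relPert r S D β :=
    div_nonneg (mul_nonneg hβ (FSFOA.specNorm_nonneg D)) hgap.le
  have hE : FSFOA.specNorm (β • D) ≤ FSFOA.relPert r S D β * FSFOA.spectralGap r S := by
    rw [FSFOA.specNorm_smul, abs_of_nonneg hβ, FSFOA.relPert, div_mul_cancel₀ _ hgap.ne']
  have h := FSFOA.abs_sqrt_tailEnergy_sub_le hr hrmn hSVD hgap hτ0 hτ hE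
  have hF : FSFOA.complProj U r * S * FSFOA.complProj V r +
      β • (FSFOA.complProj U r * D * FSFOA.complProj V r) =
      FSFOA.complProj U r * (S + β • D) * FSFOA.complProj V r := by
    rw [Matrix.mul_add, Matrix.add_mul, Matrix.mul_smul, Matrix.smul_mul]
  rw [FSFOA.tailRatio, FSFOA.surrogateRatio, hF, ← sub_div, abs_div,
    abs_of_nonneg (FSFOA.frobNorm_nonneg (S + β • D))]
  -- Both ratios share the denominator `‖S + β D‖_F`, which also multiplies the bound, so it
  -- cancels; only its nonnegativity is needed.
  exact div_le_of_le_mul₀ (FSFOA.frobNorm_nonneg _) (by positivity) h
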